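/- **Local limit theorem for lacunary Walsh series.** Let $r_0$ be the $1$-periodic function on $\mathbb{R}$ with $r_0=1$ on $[0,\tfrac12)$ and $r_0=-1$ on $[\tfrac12,1)$, and let $r_i(x)=r_0(2^i x)$ for $i\ge 0$. For $N\in\mathbb{N}$ with dyadic expansion $N=\sum_{i\ge0}k_i2^i$, $k_i\in\{0,1\}$, let $W_N=\prod_{i\ge 0} r_i^{k_i}$ be the $N$th Walsh function. Let $q>1$ and let $(m_k)_{k\ge1}$ be a sequence of positive integers with $m_{k+1}/m_k\ge q$ for all $k\ge1$. Let $(a_{k,n})_{1\le k\le n}$ be a triangular array of real numbers, and put $$S_n^{\mathrm W}(x)=\sum_{k=1}^n a_{k,n}W_{m_k}(x)\quad(0\le x\le 1),\qquad A_n=\Big(\sum_{k=1}^n a_{k,n}^2\Big)^{1/2},\qquad d_n=\max_{1\le k\le n}|a_{k,n}|.$$ Suppose that $A_n\to\infty$ as $n\to\infty$, and moreover that * if $q\ge2$: $\sum_{k=1}^n a_{k,n}^4\to\kappa_4$ for some finite $\kappa_4$, and $n\,d_n^5\to0$; * if $1<q<2$: $\varepsilon>0$ is such that $n^{1+\varepsilon}d_n^3\to0$.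 Let $\gamma=\tfrac1{10}$ if $q\ge2$ and $\gamma=\min\{\tfrac{\varepsilon}{3},\tfrac13\}$ if $1<q<2$. Let $y\in\mathbb{R}$ and let $B\subset\mathbb{R}$ be a Jordan measurable set (that is, bounded with boundary of Lebesgue measure zero) with Lebesgue measure $|B|>0$. Then for every $\delta\in(0,\gamma+\tfrac12)$, $$\lim_{n\to\infty}A_n^{2\delta}\,\Big|\Big\{x\in[0,1]\,:\,\frac{S_n^{\mathrm W}(x)}{A_n}-y\in\frac{1}{A_n^{2\delta}}B\Big\}\Big|=\frac{e^{-y^2/2}}{\sqrt{2\pi}}\,|B| ,$$ where $|\cdot|$ denotes Lebesgue measure. -/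

import Mathlib

open Filter Topology MeasureTheory
open scoped Pointwise

noncomputable section

/-- The Rademacher functions `r_i (x) = r_0 (2 ^ i * x)`, where `r_0` is the function of period `1`
that is `1` on `[0, 1/2)` and `-1` on `[1/2, 1)`. -/
def rademacher (i : ℕ) (x : ℝ) : ℝ :=
  if Int.fract ((2 : ℝ) ^ i * x) < 1 / 2 then 1 else -1

/-- The Walsh function `W_N = ∏ i, r_i ^ k_i`, where `N = ∑ i, k_i * 2 ^ i` with `k_i ∈ {0, 1}`
is the dyadic expansion of `N` (all binary digits of `N` sit at positions below `N.size`). -/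
def walsh (N : ℕ) (x : ℝ) : ℝ :=
  ∏ i ∈ Finset.range N.size, rademacher i x ^ (N.testBit i).toNat

/-- The sequence of positive integers `m 1, m 2, …` satisfies `m (k + 1) / m k ≥ q` for all
`k ≥ 1`. (The value `m 0` plays no role; for `q > 1` the sequence is strictly increasing.) -/
def IsLacunary (q : ℝ) (m : ℕ → ℕ) : Prop :=
  ∀ k : ℕ, 1 ≤ k → 0 < m k ∧ q ≤ (m (k + 1) : ℝ) / (m k : ℝ)

/-- `S_n (x) = ∑_{k = 1}^n a_{k, n} W_{m_k} (x)`; the entry `a_{k, n}` is written `a k n`. -/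
def walshSum (a : ℕ → ℕ → ℝ) (m : ℕ → ℕ) (n : ℕ) (x : ℝ) : ℝ :=
  ∑ k ∈ Finset.Icc 1 n, a k n * walsh (m k) x

/-- `A_n = (∑_{k = 1}^n a_{k, n} ^ 2) ^ (1 / 2)`. -/
def arrayNorm (a : ℕ → ℕ → ℝ) (n : ℕ) : ℝ :=
  Real.sqrt (∑ k ∈ Finset.Icc 1 n, a k n ^ 2)

/-- `d_n = max_{1 ≤ k ≤ n} |a_{k, n}|` (and `d_0 = 0`). -/
def arrayMax (a : ℕ → ℕ → ℝ) (n : ℕ) : ℝ :=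
  ((Finset.Icc 1 n).sup fun k => ‖a k n‖₊ : NNReal)

/-- Jordan measurable subsets of the line: bounded, with a boundary of Lebesgue measure zero. -/
def IsJordanMeasurable (B : Set ℝ) : Prop :=
  Bornology.IsBounded B ∧ volume (frontier B) = 0

/-- The exponent `γ`: `1 / 10` if `q ≥ 2`, and `min {ε / 3, 1 / 3}` if `q < 2`. -/
def walshGamma (q ε : ℝ) : ℝ :=
  if 2 ≤ q then 1 / 10 else min (ε / 3) (1 / 3)

end

/-! A Walsh function takes the values 1 and -1, so exp(ibW) = cos b · (1 + i tan b · W). Hence the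
characteristic function of S_n at t is ∏ cos(t a_k) times the mean of the Riesz product ∏ (1 + i
tan(t a_k) W_{m_k}). The cosine product alone gives the Gaussian limit and a Gaussian bound; the
work is to show that the mean of the Riesz product is close to 1, uniformly for |t| ≤ A_n^{2γ}.

Since W_u W_v = W_{u xor v}, the Walsh coefficients R_n(u) of Riesz products satisfy R_{n+1}(u) =
R_n(u) + c_{n+1} R_n(u xor m_{n+1}), and R_n(u) = 0 once u exceeds the reach of xors of m_1, …, m_n.
For q ≥ 2 the frequency m_{n+1} is always out of reach, so the mean is exactly 1. For 1 < q < 2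
reaching m_{n+1} costs at least two further coefficients, so each step changes the mean by O(τ³)
relative to the current bound, where τ bounds |c_k|: `exists_norm_rieszCoeff_sub_one_le`. With τ of
order A_n^{2γ} d_n the total error tends to 0 because n τ³ → 0.

The probabilistic half is `tendsto_measureReal_of_charFun_bound`: for a Schwartz test function on
the scale h = A_n^{-2δ}, Fourier inversion turns the expectation into an integral of the
characteristic function. The Gaussian bound dominates it up to |s| = A_n^{2γ+1}, a power of 1/h
larger than 1 exactly because δ < γ + 1/2, and Schwartz decay handles the rest. Smooth cutoffs then
approximate the indicator of B from both sides. -/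

lemma Nat.xor_le_add (a b : ℕ) : a ^^^ b ≤ a + b := by
  induction a using Nat.strong_induction_on generalizing b with
  | _ a ih =>
    rcases Nat.eq_zero_or_pos a with rfl | ha
    · simp
    · have h1 := ih (a / 2) (by omega) (b / 2)
      have h2 : (a ^^^ b) / 2 = a / 2 ^^^ b / 2 := Nat.xor_div_two
      have h3 : (a ^^^ b) % 2 = (a + b) % 2 := Nat.xor_mod_two_eq
      omega

/-- A reverse triangle inequality: multiplying by a Walsh function of low frequency b lowers a high
frequency a by at most b. -/
lemma Nat.le_xor_add (a b : ℕ) : a ≤ (a ^^^ b) + b := by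
  have h := Nat.xor_le_add (a ^^^ b) b
  rwa [Nat.xor_assoc, Nat.xor_self, Nat.xor_zero] at h

/-! ### Walsh functions -/

lemma rademacher_mul_self (i : ℕ) (x : ℝ) : rademacher i x * rademacher i x = 1 := by
  unfold rademacher; split_ifs <;> norm_num

lemma rademacher_succ (i : ℕ) (x : ℝ) : rademacher (i + 1) x = rademacher i (2 * x) := by
  unfold rademacher; rw [pow_succ, mul_assoc]

lemma rademacher_add_one (i : ℕ) (x : ℝ) : rademacher i (x + 1) = rademacher i x := by
  unfold rademacher
  have : (2 : ℝ) ^ i * (x + 1) = 2 ^ i * x + ((2 ^ i : ℕ) : ℝ) := by push_cast; ring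
  rw [this, Int.fract_add_natCast]

lemma measurable_rademacher (i : ℕ) : Measurable (rademacher i) := by
  unfold rademacher
  refine Measurable.ite ?_ measurable_const measurable_const
  exact measurableSet_lt (measurable_fract.comp (measurable_const_mul _)) measurable_const

lemma walsh_eq_prod {N M : ℕ} (h : N.size ≤ M) (x : ℝ) :
    walsh N x = ∏ i ∈ Finset.range M, rademacher i x ^ (N.testBit i).toNat := by
  unfold walsh
  refine Finset.prod_subset (Finset.range_mono h) fun i _ hi => ?_
  have : N < 2 ^ i := Nat.size_le.1 (by simpa using hi)
  simp [Nat.testBit_lt_two_pow this]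

lemma walsh_mul_walsh (u v : ℕ) (x : ℝ) : walsh u x * walsh v x = walsh (u ^^^ v) x := by
  set M := max (max u.size v.size) (u ^^^ v).size
  rw [walsh_eq_prod (M := M) (by omega), walsh_eq_prod (N := v) (M := M) (by omega),
    walsh_eq_prod (N := u ^^^ v) (M := M) (by omega), ← Finset.prod_mul_distrib]
  refine Finset.prod_congr rfl fun i _ => ?_
  rw [Nat.testBit_xor]
  cases u.testBit i <;> cases v.testBit i <;> simp [rademacher_mul_self]

@[simp] lemma walsh_zero (x : ℝ) : walsh 0 x = 1 := by simp [walsh]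

lemma walsh_mul_self (u : ℕ) (x : ℝ) : walsh u x * walsh u x = 1 := by
  rw [walsh_mul_walsh, Nat.xor_self, walsh_zero]

lemma abs_walsh (u : ℕ) (x : ℝ) : |walsh u x| = 1 := by
  have := walsh_mul_self u x
  rcases mul_self_eq_one_iff.1 this with h | h <;> simp [h]

lemma measurable_walsh (u : ℕ) : Measurable (walsh u) := by
  unfold walsh
  exact Finset.measurable_fun_prod _ fun i _ => (measurable_rademacher i).pow_const _

lemma walsh_add_one (u : ℕ) (x : ℝ) : walsh u (x + 1) = walsh u x := by
  simp [walsh, rademacher_add_one]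

lemma walsh_bit (b : Bool) (u : ℕ) (x : ℝ) :
    walsh (Nat.bit b u) x = rademacher 0 x ^ b.toNat * walsh u (2 * x) := by
  have h : (Nat.bit b u).size ≤ u.size + 1 := by
    by_cases h : Nat.bit b u = 0
    · simp [h]
    · rw [Nat.size_bit h]
  rw [walsh_eq_prod h, Finset.prod_range_succ', Nat.testBit_bit_zero, mul_comm, walsh]
  simp only [Nat.testBit_bit_succ, rademacher_succ]

lemma intervalIntegrable_walsh (u : ℕ) (a b : ℝ) : IntervalIntegrable (walsh u) volume a b := by
  refine (intervalIntegrable_const (c := (1 : ℝ))).mono_fun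
    (measurable_walsh u).aestronglyMeasurable ?_
  exact Eventually.of_forall fun x => by simp [abs_walsh]

lemma integral_walsh_comp_two_mul (u : ℕ) (k : ℝ) :
    ∫ x in (k / 2)..((k + 1) / 2), walsh u (2 * x) = (∫ x in k..(k + 1), walsh u x) / 2 := by
  rw [intervalIntegral.integral_comp_mul_left _ (by norm_num : (2 : ℝ) ≠ 0)]
  rw [mul_div_cancel₀ _ (by norm_num : (2 : ℝ) ≠ 0), mul_div_cancel₀ _ (by norm_num : (2 : ℝ) ≠ 0)]
  simp; ring

/-- The lowest binary digit contributes r_0, which is constant on each half of [0, 1], and the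
remaining digits give a Walsh function at 2x. The halves contribute equally up to the sign of r_0,
so they cancel when the digit is 1. -/
lemma integral_walsh_bit (b : Bool) (u : ℕ) :
    ∫ x in (0 : ℝ)..1, walsh (Nat.bit b u) x
      = if b then 0 else ∫ x in (0 : ℝ)..1, walsh u x := by
  have hper : ∫ x in (1 : ℝ)..(1 + 1), walsh u x = ∫ x in (0 : ℝ)..1, walsh u x := by
    have h : Function.Periodic (walsh u) 1 := walsh_add_one u
    simpa using h.intervalIntegral_add_eq 1 0
  have h0 := integral_walsh_comp_two_mul u 0
  have h1 := integral_walsh_comp_two_mul u 1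
  rw [zero_div, zero_add] at h0
  rw [hper, show ((1 : ℝ) + 1) / 2 = 1 by norm_num] at h1
  rw [← intervalIntegral.integral_add_adjacent_intervals
    (intervalIntegrable_walsh _ 0 (1 / 2)) (intervalIntegrable_walsh _ (1 / 2) 1)]
  have e0 : ∫ x in (0 : ℝ)..(1 / 2), walsh (Nat.bit b u) x
      = ∫ x in (0 : ℝ)..(1 / 2), walsh u (2 * x) := by
    refine intervalIntegral.integral_congr_ae ?_
    -- The integral runs over (0, 1/2], but r_0 is already -1 at the right endpoint.
    have : ∀ᵐ x : ℝ, x ≠ 1 / 2 := by simp [ae_iff]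
    filter_upwards [this] with x hx hx'
    rw [Set.uIoc_of_le (by norm_num)] at hx'
    have hlt : x < 1 / 2 := lt_of_le_of_ne hx'.2 hx
    have : rademacher 0 x = 1 := by
      unfold rademacher
      rw [pow_zero, one_mul, Int.fract_eq_self.2 ⟨hx'.1.le, by linarith⟩, if_pos hlt]
    rw [walsh_bit, this, one_pow, one_mul]
  have e1 : ∫ x in (1 / 2 : ℝ)..1, walsh (Nat.bit b u) x
      = ∫ x in (1 / 2 : ℝ)..1, (-1) ^ b.toNat * walsh u (2 * x) := by
    refine intervalIntegral.integral_congr_ae ?_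
    have : ∀ᵐ x : ℝ, x ≠ 1 := by simp [ae_iff]
    filter_upwards [this] with x hx hx'
    rw [Set.uIoc_of_le (by norm_num)] at hx'
    have hlt : x < 1 := lt_of_le_of_ne hx'.2 hx
    have : rademacher 0 x = -1 := by
      unfold rademacher
      rw [pow_zero, one_mul, Int.fract_eq_self.2 ⟨by linarith [hx'.1], hlt⟩,
        if_neg (not_lt.2 hx'.1.le)]
    rw [walsh_bit, this]
  rw [e0, e1, intervalIntegral.integral_const_mul, h0, h1]
  cases b
  · simp
  · simp

lemma integral_walsh (u : ℕ) : ∫ x in (0 : ℝ)..1, walsh u x = if u = 0 then 1 else 0 := by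
  induction u using Nat.binaryRec' with
  | zero => simp
  | bit b n h ih =>
    rw [integral_walsh_bit]
    cases b
    · have hn : n ≠ 0 := fun hn => by simpa using h hn
      simp [ih, hn]
    · simp

/-! ### Integrals of Riesz products -/

/-- The `u`-th Walsh coefficient of the Riesz product `∏ k ∈ Icc 1 n, (1 + c k * W_{m k})`. -/
noncomputable def rieszCoeff (c : ℕ → ℂ) (m : ℕ → ℕ) (n u : ℕ) : ℂ :=
  ∫ x in (0 : ℝ)..1, (walsh u x : ℂ) * ∏ k ∈ Finset.Icc 1 n, (1 + c k * (walsh (m k) x : ℂ))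

lemma rieszCoeff_zero (c : ℕ → ℂ) (m : ℕ → ℕ) (u : ℕ) :
    rieszCoeff c m 0 u = if u = 0 then 1 else 0 := by
  have : ∫ x in (0 : ℝ)..1, (walsh u x : ℂ) = ((∫ x in (0 : ℝ)..1, walsh u x : ℝ) : ℂ) :=
    intervalIntegral.integral_ofReal
  simp only [rieszCoeff, Finset.Icc_eq_empty_of_lt zero_lt_one, Finset.prod_empty, mul_one, this,
    integral_walsh]
  split_ifs <;> simp

lemma intervalIntegrable_riesz (c : ℕ → ℂ) (m : ℕ → ℕ) (n u : ℕ) :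
    IntervalIntegrable (fun x : ℝ => (walsh u x : ℂ) *
      ∏ k ∈ Finset.Icc 1 n, (1 + c k * (walsh (m k) x : ℂ))) volume 0 1 := by
  have hm : ∀ v, Measurable fun x : ℝ => (walsh v x : ℂ) := fun v =>
    Complex.measurable_ofReal.comp (measurable_walsh v)
  refine (intervalIntegrable_const (c := ∏ k ∈ Finset.Icc 1 n, (1 + ‖c k‖))).mono_fun ?_ ?_
  · refine Measurable.aestronglyMeasurable ?_
    exact (hm u).mul (Finset.measurable_fun_prod _ fun k _ =>
      measurable_const.add (measurable_const.mul (hm _)))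
  · refine Eventually.of_forall fun x => ?_
    have hw : ∀ v, ‖(walsh v x : ℂ)‖ = 1 := fun v => by
      rw [Complex.norm_real, Real.norm_eq_abs, abs_walsh]
    simp only [norm_mul, norm_prod, hw, one_mul]
    refine Finset.prod_le_prod (fun k _ => norm_nonneg _) fun k _ => ?_
    rw [Real.norm_of_nonneg (by positivity)]
    refine (norm_add_le _ _).trans ?_
    rw [norm_mul, hw]; simp

lemma rieszCoeff_succ (c : ℕ → ℂ) (m : ℕ → ℕ) (n u : ℕ) :
    rieszCoeff c m (n + 1) u
      = rieszCoeff c m n u + c (n + 1) * rieszCoeff c m n (u ^^^ m (n + 1)) := by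
  unfold rieszCoeff
  rw [← intervalIntegral.integral_const_mul, ← intervalIntegral.integral_add
    (intervalIntegrable_riesz c m n u) ((intervalIntegrable_riesz c m n _).const_mul _)]
  refine intervalIntegral.integral_congr fun x _ => ?_
  simp only [Finset.prod_Icc_succ_top (Nat.le_add_left 1 n), ← walsh_mul_walsh]
  push_cast; ring

/-- The numbers below 2 ^ s are closed under xor, so the whole spectrum of the product lies there.
-/
lemma rieszCoeff_eq_zero_of_two_pow_le {c : ℕ → ℂ} {m : ℕ → ℕ} {n s u : ℕ}
    (hm : ∀ k ∈ Finset.Icc 1 n, m k < 2 ^ s) (hu : 2 ^ s ≤ u) : rieszCoeff c m n u = 0 := by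
  induction n generalizing u with
  | zero =>
    have : u ≠ 0 := by have := Nat.two_pow_pos s; omega
    simp [rieszCoeff_zero, this]
  | succ n ih =>
    have hm' : ∀ k ∈ Finset.Icc 1 n, m k < 2 ^ s := fun k hk => hm k (by
      simp only [Finset.mem_Icc] at hk ⊢; omega)
    rw [rieszCoeff_succ, ih hm' hu, ih hm', mul_zero, add_zero]
    by_contra! h
    have := Nat.xor_lt_two_pow h (hm (n + 1) (by simp))
    rw [Nat.xor_assoc, Nat.xor_self, Nat.xor_zero] at this
    omega

lemma IsLacunary.mul_le {q : ℝ} {m : ℕ → ℕ} (hm : IsLacunary q m) {k : ℕ} (hk : 1 ≤ k) :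
    q * m k ≤ m (k + 1) := by
  obtain ⟨h0, h1⟩ := hm k hk
  rwa [le_div_iff₀ (by exact_mod_cast h0)] at h1

lemma IsLacunary.le {q : ℝ} (hq : 1 ≤ q) {m : ℕ → ℕ} (hm : IsLacunary q m) {k n : ℕ}
    (hk : 1 ≤ k) (hkn : k ≤ n) : m k ≤ m n := by
  induction n, hkn using Nat.le_induction with
  | base => rfl
  | succ n hn ih =>
    refine ih.trans ?_
    have h := hm.mul_le (hk.trans hn)
    have : (m n : ℝ) ≤ m (n + 1) := by nlinarith [Nat.cast_nonneg (α := ℝ) (m n)]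
    exact_mod_cast this

lemma IsLacunary.rieszCoeff_eq_zero {q : ℝ} (hq : 1 ≤ q) {m : ℕ → ℕ} (hm : IsLacunary q m)
    (c : ℕ → ℂ) {n u : ℕ} (hu : 2 * (m (n + 1) : ℝ) ≤ q * u) : rieszCoeff c m n u = 0 := by
  have hpos : ∀ k, 1 ≤ k → (0 : ℝ) < m k := fun k hk => by exact_mod_cast (hm k hk).1
  rcases n with _ | n
  · have : u ≠ 0 := by
      rintro rfl
      have := hpos 1 le_rfl
      norm_num at hu; linarith
    simp [rieszCoeff_zero, this]
  · refine rieszCoeff_eq_zero_of_two_pow_le (s := (m (n + 1)).size) (fun k hk => ?_) ?_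
    · rw [Finset.mem_Icc] at hk
      exact (hm.le hq hk.1 hk.2).trans_lt (Nat.lt_size_self _)
    · have h1 : 2 * m (n + 1) ≤ u := by
        have h2 := hm.mul_le (k := n + 1) (by omega)
        have h3 : q * (2 * m (n + 1)) ≤ q * u := by linarith
        have := le_of_mul_le_mul_left h3 (by linarith)
        exact_mod_cast this
      have hp := (hm (n + 1) (by omega)).1
      have h2 : 2 ^ ((m (n + 1)).size - 1) ≤ m (n + 1) := by
        have h4 : 0 < (m (n + 1)).size := Nat.size_pos.2 hp
        exact Nat.lt_size.1 (by omega)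
      have h4 : 0 < (m (n + 1)).size := Nat.size_pos.2 hp
      obtain ⟨s, hs⟩ : ∃ s, (m (n + 1)).size = s + 1 := ⟨_, (Nat.sub_add_cancel h4).symm⟩
      rw [hs] at h2 ⊢
      rw [pow_succ]
      simp only [Nat.add_sub_cancel] at h2
      omega

lemma IsLacunary.rieszCoeff_eq_one {q : ℝ} (hq : 2 ≤ q) {m : ℕ → ℕ} (hm : IsLacunary q m)
    (c : ℕ → ℂ) (n : ℕ) : rieszCoeff c m n 0 = 1 := by
  induction n with
  | zero => simp [rieszCoeff_zero]
  | succ n ih =>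
    rw [rieszCoeff_succ, ih, Nat.zero_xor, hm.rieszCoeff_eq_zero (by linarith), mul_zero, add_zero]
    nlinarith [Nat.cast_nonneg (α := ℝ) (m (n + 1))]

/-! ### Coefficient bounds for Riesz products of ratio q > 1 -/

section Bounds

variable {q : ℝ} {m : ℕ → ℕ} {c : ℕ → ℂ} {τ P : ℝ}

lemma norm_rieszCoeff_succ_le (hc : ∀ k, ‖c k‖ ≤ τ) (n u : ℕ) :
    ‖rieszCoeff c m (n + 1) u‖
      ≤ ‖rieszCoeff c m n u‖ + τ * ‖rieszCoeff c m n (u ^^^ m (n + 1))‖ := by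
  rw [rieszCoeff_succ]
  refine (norm_add_le _ _).trans ?_
  rw [norm_mul]
  gcongr
  exact hc _

/-- Peel off the top factors one at a time. Each costs at most τ P ^ n, and after I of them the
ratio of u to the next frequency has grown by q ^ I, which puts u out of reach. So a frequency
comparable to m (n + 1) has a coefficient of order τ. -/
lemma norm_rieszCoeff_le_mul (hq : 1 ≤ q) (hm : IsLacunary q m) (hc : ∀ k, ‖c k‖ ≤ τ)
    (hP : 1 ≤ P) (I : ℕ) {n u : ℕ} (h0 : ∀ k < n, ∀ v, ‖rieszCoeff c m k v‖ ≤ P ^ k)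
    (hu : 2 * (m (n + 1) : ℝ) ≤ q ^ (I + 1) * u) :
    ‖rieszCoeff c m n u‖ ≤ I * τ * P ^ n := by
  have hτ : 0 ≤ τ := (norm_nonneg _).trans (hc 0)
  induction I generalizing n u with
  | zero => simp [hm.rieszCoeff_eq_zero hq c (by simpa using hu)]
  | succ I ih =>
    rcases n with _ | n
    · have : u ≠ 0 := by
        rintro rfl
        have : (0 : ℝ) < m 1 := by exact_mod_cast (hm 1 le_rfl).1
        norm_num at hu; linarith
      simp only [rieszCoeff_zero, if_neg this, norm_zero]
      positivity
    · have h1 := ih (n := n) (u := u) (fun k hk => h0 k (by omega)) (by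
        have h2 := hm.mul_le (k := n + 1) (by omega)
        have h3 : q * (2 * m (n + 1)) ≤ q * (q ^ (I + 1) * u) := by
          rw [pow_succ] at hu; linarith
        exact le_of_mul_le_mul_left h3 (by linarith))
      have h2 := h0 n (by omega) (u ^^^ m (n + 1))
      calc ‖rieszCoeff c m (n + 1) u‖ ≤ I * τ * P ^ n + τ * P ^ n :=
            (norm_rieszCoeff_succ_le hc n u).trans (by gcongr)
        _ = ((I + 1 : ℕ) : ℝ) * τ * P ^ n := by push_cast; ring
        _ ≤ _ := by gcongr; omega

/-- The same peeling, but now each removed factor leaves a frequency that is still comparable to the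
removed one: u ≥ ρ m (n + 2) ≥ ρ q m (n + 1) with ρ q > 1, so u xor m (n + 1) is at least (ρ q - 1)
m (n + 1). The first-order bound applies to it and supplies the second factor τ. -/
lemma norm_rieszCoeff_le_mul_sq (hq : 1 ≤ q) (hm : IsLacunary q m) (hc : ∀ k, ‖c k‖ ≤ τ)
    (hP : 1 ≤ P) {ρ : ℝ} {I : ℕ} (hρ : 0 < ρ) (hI : 2 ≤ q ^ (I + 1) * (ρ * q - 1)) (J : ℕ)
    {n u : ℕ} (h0 : ∀ k < n, ∀ v, ‖rieszCoeff c m k v‖ ≤ P ^ k)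
    (hu : 2 * (m (n + 1) : ℝ) ≤ q ^ (J + 1) * u) (hu' : ρ * m (n + 1) ≤ u) :
    ‖rieszCoeff c m n u‖ ≤ J * I * τ ^ 2 * P ^ n := by
  have hτ : 0 ≤ τ := (norm_nonneg _).trans (hc 0)
  induction J generalizing n u with
  | zero => simp [hm.rieszCoeff_eq_zero hq c (by simpa using hu)]
  | succ J ih =>
    rcases n with _ | n
    · have : u ≠ 0 := by
        rintro rfl
        have : (0 : ℝ) < m 1 := by exact_mod_cast (hm 1 le_rfl).1
        norm_num at hu; linarith
      simp only [rieszCoeff_zero, if_neg this, norm_zero]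
      positivity
    · have hmq := hm.mul_le (k := n + 1) (by omega)
      have hmn : (0 : ℝ) ≤ m (n + 1) := Nat.cast_nonneg _
      have h1 := ih (n := n) (u := u) (fun k hk => h0 k (by omega)) (by
        have h3 : q * (2 * m (n + 1)) ≤ q * (q ^ (J + 1) * u) := by
          rw [pow_succ] at hu; linarith
        exact le_of_mul_le_mul_left h3 (by linarith)) (by
        refine le_trans ?_ hu'
        gcongr
        exact hm.le hq (by omega) (by omega))
      have h2 := norm_rieszCoeff_le_mul hq hm hc hP I (n := n) (u := u ^^^ m (n + 1))
        (fun k hk => h0 k (by omega)) (by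
        have h3 : (u : ℝ) ≤ (u ^^^ m (n + 1) : ℕ) + m (n + 1) := by
          exact_mod_cast Nat.le_xor_add u (m (n + 1))
        have h4 : ρ * (q * m (n + 1)) ≤ ρ * m (n + 1 + 1) := by gcongr
        have h5 : (ρ * q - 1) * m (n + 1) ≤ (u ^^^ m (n + 1) : ℕ) := by linarith
        calc 2 * (m (n + 1) : ℝ) ≤ q ^ (I + 1) * (ρ * q - 1) * m (n + 1) := by gcongr
          _ = q ^ (I + 1) * ((ρ * q - 1) * m (n + 1)) := by ring
          _ ≤ _ := by gcongr)
      calc ‖rieszCoeff c m (n + 1) u‖ ≤ J * I * τ ^ 2 * P ^ n + τ * (I * τ * P ^ n) :=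
            (norm_rieszCoeff_succ_le hc n u).trans (by gcongr)
        _ = ((J + 1 : ℕ) : ℝ) * I * τ ^ 2 * P ^ n := by push_cast; ring
        _ ≤ _ := by gcongr; omega

/-- Walsh coefficients of Riesz products over lacunary sequences: all are at most
`(1 + K τ ^ 3) ^ n`, and the mean is within `(1 + K τ ^ 3) ^ n - 1` of `1`. -/
lemma exists_norm_rieszCoeff_sub_one_le (hq : 1 < q) :
    ∃ K τ₀ : ℝ, 0 ≤ K ∧ 0 < τ₀ ∧ ∀ (m : ℕ → ℕ), IsLacunary q m → ∀ (c : ℕ → ℂ) (τ : ℝ),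
      (∀ k, ‖c k‖ ≤ τ) → τ ≤ τ₀ → ∀ n, ‖rieszCoeff c m n 0 - 1‖ ≤ (1 + K * τ ^ 3) ^ n - 1 := by
  -- Choosing 1/q < ρ < 1 makes both ρ q - 1 and 1 - ρ positive.
  obtain ⟨ρ, hρ1, hρ2⟩ := exists_between (inv_lt_one_of_one_lt₀ hq)
  have hq0 : 0 < q := by linarith
  have hρ0 : 0 < ρ := (inv_pos.2 hq0).trans hρ1
  have hρq : 0 < ρ * q - 1 := by
    have := (inv_lt_iff_one_lt_mul₀ hq0).1 hρ1
    linarith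
  have hlim : Tendsto (fun I : ℕ => q ^ (I + 1)) atTop atTop :=
    (tendsto_pow_atTop_atTop_of_one_lt hq).comp (tendsto_add_atTop_nat 1)
  -- One I serves three purposes: the inner bound after peeling in the second-order estimate, the
  -- first-order estimate for u ≥ (1 - ρ) m (n + 1), and the number of peelings for u ≥ ρ m (n + 1).
  obtain ⟨I, hI1, hI2, hI3⟩ := ((hlim.eventually_ge_atTop (2 / (ρ * q - 1))).and
    ((hlim.eventually_ge_atTop (2 / (1 - ρ))).and (hlim.eventually_ge_atTop (2 / ρ)))).exists
  rw [div_le_iff₀ hρq] at hI1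
  rw [div_le_iff₀ (by linarith)] at hI2
  rw [div_le_iff₀ hρ0] at hI3
  refine ⟨I * I, 1 / (I + 1), by positivity, by positivity, fun m hm c τ hc hτ₀ => ?_⟩
  have hτ : 0 ≤ τ := (norm_nonneg _).trans (hc 0)
  rw [le_div_iff₀ (by positivity)] at hτ₀
  set P : ℝ := 1 + I * I * τ ^ 3 with hPdef
  have hP : 1 ≤ P := by
    have : 0 ≤ I * I * τ ^ 3 := by positivity
    linarith
  -- If u is small, u xor m (n + 1) is still at least ρ m (n + 1), so its coefficient is of order τ
  -- ^ 2 and the increment of order τ ^ 3.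
  have small : ∀ n u, (∀ k < n, ∀ v, ‖rieszCoeff c m k v‖ ≤ P ^ k) →
      u ≤ (1 - ρ) * m (n + 1) →
      ∀ v : ℕ, (v : ℝ) = u → τ * ‖rieszCoeff c m n (v ^^^ m (n + 1))‖ ≤ (P - 1) * P ^ n := by
    rintro n _ h0 hu v rfl
    have h3 : (m (n + 1) : ℝ) ≤ (v ^^^ m (n + 1) : ℕ) + v := by
      rw [Nat.xor_comm]
      exact_mod_cast Nat.le_xor_add (m (n + 1)) v
    have h4 : ρ * m (n + 1) ≤ (v ^^^ m (n + 1) : ℕ) := by linarith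
    have h5 := norm_rieszCoeff_le_mul_sq hq.le hm hc hP hρ0 hI1 I h0 (by
      calc 2 * (m (n + 1) : ℝ) ≤ q ^ (I + 1) * ρ * m (n + 1) := by gcongr
        _ = q ^ (I + 1) * (ρ * m (n + 1)) := by ring
        _ ≤ _ := by gcongr) h4
    calc _ ≤ τ * (I * I * τ ^ 2 * P ^ n) := by gcongr
      _ = _ := by rw [hPdef]; ring
  have key : ∀ n, ∀ v, ‖rieszCoeff c m n v‖ ≤ P ^ n := by
    intro n
    induction n using Nat.strong_induction_on with
    | _ n h0 =>
      intro v
      rcases n with _ | n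
      · rw [rieszCoeff_zero]
        split_ifs <;> simp
      · have h0' : ∀ k < n, ∀ v, ‖rieszCoeff c m k v‖ ≤ P ^ k := fun k hk => h0 k (by omega)
        have hPn : 0 ≤ P ^ n := by positivity
        refine (norm_rieszCoeff_succ_le hc n v).trans ?_
        rcases le_total (v : ℝ) ((1 - ρ) * m (n + 1)) with hv | hv
        · have := small n v h0' hv v rfl
          have := h0 n (by omega) v
          rw [pow_succ]; linarith
        -- If u is large, both terms together are at most τ (I + 1) P ^ n, which τ₀ = 1 / (I + 1)
        -- keeps below P ^ n.
        · have h1 := norm_rieszCoeff_le_mul hq.le hm hc hP I h0' (u := v) (by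
            calc 2 * (m (n + 1) : ℝ) ≤ q ^ (I + 1) * (1 - ρ) * m (n + 1) := by gcongr
              _ = q ^ (I + 1) * ((1 - ρ) * m (n + 1)) := by ring
              _ ≤ _ := by gcongr)
          have h2 := h0 n (by omega) (v ^^^ m (n + 1))
          calc _ ≤ I * τ * P ^ n + τ * P ^ n := by gcongr
            _ = τ * (I + 1) * P ^ n := by ring
            _ ≤ 1 * P ^ n := by gcongr
            _ ≤ P ^ (n + 1) := by rw [one_mul]; exact pow_le_pow_right₀ hP (by omega)
  intro n
  induction n with
  | zero => simp [rieszCoeff_zero]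
  | succ n ih =>
    have h1 := small n 0 (fun k _ => key k) (mul_nonneg (by linarith) (Nat.cast_nonneg _)) 0 (by simp)
    have h2 : ‖c (n + 1) * rieszCoeff c m n (0 ^^^ m (n + 1))‖ ≤ (P - 1) * P ^ n := by
      rw [norm_mul]
      exact (mul_le_mul_of_nonneg_right (hc _) (norm_nonneg _)).trans h1
    rw [rieszCoeff_succ, add_sub_right_comm]
    refine (norm_add_le _ _).trans ?_
    rw [pow_succ]; linarith

end Bounds

/-! ### The characteristic function of a Walsh sum -/

lemma abs_le_arrayMax (a : ℕ → ℕ → ℝ) {n k : ℕ} (hk : k ∈ Finset.Icc 1 n) :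
    |a k n| ≤ arrayMax a n := by
  have h : ‖a k n‖₊ ≤ (Finset.Icc 1 n).sup fun k => ‖a k n‖₊ :=
    Finset.le_sup (f := fun k => ‖a k n‖₊) hk
  have h' : ((‖a k n‖₊ : NNReal) : ℝ) ≤ arrayMax a n := NNReal.coe_le_coe.2 h
  simpa using h'

lemma arrayMax_nonneg (a : ℕ → ℕ → ℝ) (n : ℕ) : 0 ≤ arrayMax a n := NNReal.coe_nonneg _

lemma arrayNorm_nonneg (a : ℕ → ℕ → ℝ) (n : ℕ) : 0 ≤ arrayNorm a n := Real.sqrt_nonneg _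

lemma arrayNorm_sq (a : ℕ → ℕ → ℝ) (n : ℕ) :
    arrayNorm a n ^ 2 = ∑ k ∈ Finset.Icc 1 n, a k n ^ 2 :=
  Real.sq_sqrt (Finset.sum_nonneg fun _ _ => sq_nonneg _)

lemma arrayNorm_le (a : ℕ → ℕ → ℝ) (n : ℕ) : arrayNorm a n ≤ √n * arrayMax a n := by
  refine abs_le_of_sq_le_sq' ?_ (mul_nonneg (Real.sqrt_nonneg _) (arrayMax_nonneg a n)) |>.2
  rw [arrayNorm_sq, mul_pow, Real.sq_sqrt (Nat.cast_nonneg n)]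
  calc ∑ k ∈ Finset.Icc 1 n, a k n ^ 2 ≤ ∑ _k ∈ Finset.Icc 1 n, arrayMax a n ^ 2 :=
        Finset.sum_le_sum fun k hk => by
          rw [← sq_abs]
          exact pow_le_pow_left₀ (abs_nonneg _) (abs_le_arrayMax a hk) 2
    _ = _ := by simp

lemma measurable_walshSum (a : ℕ → ℕ → ℝ) (m : ℕ → ℕ) (n : ℕ) : Measurable (walshSum a m n) := by
  unfold walshSum
  exact Finset.measurable_fun_sum _ fun k _ => (measurable_walsh _).const_mul _

lemma cos_pos_of_abs_le_one {x : ℝ} (hx : |x| ≤ 1) : 0 < Real.cos x :=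
  Real.cos_pos_of_le_one hx

lemma abs_tan_le_two_mul {x : ℝ} (hx : |x| ≤ 1) : |Real.tan x| ≤ 2 * |x| := by
  have hc : 1 / 2 ≤ Real.cos x := by
    have h1 := Real.one_sub_sq_div_two_le_cos (x := x)
    have h2 : x ^ 2 ≤ 1 := by rw [← sq_abs]; exact pow_le_one₀ (abs_nonneg _) hx
    linarith
  have hs : |Real.sin x| ≤ |x| := Real.abs_sin_le_abs
  rw [Real.tan_eq_sin_div_cos, abs_div, abs_of_pos (by linarith : 0 < Real.cos x),
    div_le_iff₀ (by linarith)]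
  nlinarith [abs_nonneg x]

lemma cexp_mul_walsh {b : ℝ} (hb : |b| ≤ 1) (u : ℕ) (x : ℝ) :
    Complex.exp (((b * walsh u x : ℝ) : ℂ) * Complex.I)
      = (Real.cos b : ℂ) * (1 + (Real.tan b * Complex.I) * (walsh u x : ℂ)) := by
  have hc : Complex.cos b ≠ 0 := by
    rw [← Complex.ofReal_cos]
    exact_mod_cast (cos_pos_of_abs_le_one hb).ne'
  rw [Complex.exp_mul_I, Real.tan_eq_sin_div_cos]
  push_cast
  rcases mul_self_eq_one_iff.1 (walsh_mul_self u x) with h | h <;> rw [h] <;> simp <;> field_simp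

/-- The characteristic function of a Walsh sum is a product of cosines times the mean of a
Riesz product. -/
lemma integral_cexp_walshSum (a : ℕ → ℕ → ℝ) (m : ℕ → ℕ) (n : ℕ) {t : ℝ}
    (ht : |t| * arrayMax a n ≤ 1) :
    ∫ x in (0 : ℝ)..1, Complex.exp ((t * walshSum a m n x : ℝ) * Complex.I)
      = ((∏ k ∈ Finset.Icc 1 n, Real.cos (t * a k n) : ℝ) : ℂ) *
        rieszCoeff (fun k => if k ∈ Finset.Icc 1 n then Real.tan (t * a k n) * Complex.I else 0)
          m n 0 := by
  rw [rieszCoeff, ← intervalIntegral.integral_const_mul]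
  refine intervalIntegral.integral_congr fun x _ => ?_
  simp only [walsh_zero, Complex.ofReal_one, one_mul, walshSum, Finset.mul_sum]
  rw [Complex.ofReal_sum, Finset.sum_mul, Complex.exp_sum, Complex.ofReal_prod,
    ← Finset.prod_mul_distrib]
  refine Finset.prod_congr rfl fun k hk => ?_
  rw [if_pos hk, ← mul_assoc, cexp_mul_walsh]
  rw [abs_mul]
  exact (mul_le_mul_of_nonneg_left (abs_le_arrayMax a hk) (abs_nonneg _)).trans ht

/-- The error is relative to the cosine product, so the characteristic function inherits the
Gaussian decay of that product. -/
lemma IsLacunary.exists_norm_integral_cexp_sub_le {q : ℝ} (hq : 1 < q) {m : ℕ → ℕ}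
    (hm : IsLacunary q m) (a : ℕ → ℕ → ℝ) {T : ℕ → ℝ} (hT0 : ∀ n, 0 ≤ T n)
    (hT : Tendsto (fun n => T n * arrayMax a n) atTop (𝓝 0))
    (hT' : q < 2 → Tendsto (fun n : ℕ => (n : ℝ) * (T n * arrayMax a n) ^ 3) atTop (𝓝 0)) :
    ∃ r : ℕ → ℝ, Tendsto r atTop (𝓝 0) ∧ ∀ᶠ n in atTop, ∀ t : ℝ, |t| ≤ T n →
      ‖(∫ x in (0 : ℝ)..1, Complex.exp ((t * walshSum a m n x : ℝ) * Complex.I))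
        - ((∏ k ∈ Finset.Icc 1 n, Real.cos (t * a k n) : ℝ) : ℂ)‖
        ≤ r n * ∏ k ∈ Finset.Icc 1 n, Real.cos (t * a k n) := by
  suffices h : ∃ r : ℕ → ℝ, Tendsto r atTop (𝓝 0) ∧ ∀ᶠ n in atTop, ∀ c : ℕ → ℂ,
      (∀ k, ‖c k‖ ≤ 2 * (T n * arrayMax a n)) → ‖rieszCoeff c m n 0 - 1‖ ≤ r n by
    obtain ⟨r, hr, h⟩ := h
    refine ⟨r, hr, ?_⟩
    filter_upwards [h, hT.eventually_le_const zero_lt_one] with n hn hn1 t ht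
    have htd : |t| * arrayMax a n ≤ T n * arrayMax a n :=
      mul_le_mul_of_nonneg_right ht (arrayMax_nonneg a n)
    have hta : ∀ k ∈ Finset.Icc 1 n, |t * a k n| ≤ T n * arrayMax a n := fun k hk => by
      rw [abs_mul]
      exact (mul_le_mul_of_nonneg_left (abs_le_arrayMax a hk) (abs_nonneg _)).trans htd
    have hpos : 0 ≤ ∏ k ∈ Finset.Icc 1 n, Real.cos (t * a k n) :=
      Finset.prod_nonneg fun k hk => (cos_pos_of_abs_le_one ((hta k hk).trans hn1)).le
    rw [integral_cexp_walshSum a m n (htd.trans hn1), ← mul_sub_one, norm_mul, Complex.norm_real,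
      Real.norm_of_nonneg hpos, mul_comm]
    refine mul_le_mul_of_nonneg_right (hn _ fun k => ?_) hpos
    split_ifs with hk
    · rw [norm_mul, Complex.norm_I, mul_one, Complex.norm_real, Real.norm_eq_abs]
      have := abs_tan_le_two_mul ((hta k hk).trans hn1)
      linarith [hta k hk]
    -- The default coefficient 0 outside 1, …, n makes the bound hold at every index.
    · rw [norm_zero]
      have := arrayMax_nonneg a n
      have := hT0 n
      positivity
  rcases le_or_gt 2 q with hq2 | hq2
  · exact ⟨0, tendsto_const_nhds, Eventually.of_forall fun n c _ => by
      simp [hm.rieszCoeff_eq_one hq2]⟩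
  · obtain ⟨K, τ₀, hK, hτ₀, h⟩ := exists_norm_rieszCoeff_sub_one_le hq
    -- From (1 + z) ^ n ≤ exp (n z) with z = K τ ^ 3; the 8 is the cube of the 2 in the bound on the
    -- tangent.
    refine ⟨fun n => Real.exp (8 * K * (n * (T n * arrayMax a n) ^ 3)) - 1, ?_, ?_⟩
    · have h1 := ((hT' hq2).const_mul (8 * K)).rexp.sub_const 1
      simpa using h1
    · filter_upwards [hT.eventually_le_const (half_pos hτ₀)] with n hn c hc
      refine (h m hm c _ hc (by linarith) n).trans ?_
      have h2 : 1 + K * (2 * (T n * arrayMax a n)) ^ 3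
          ≤ Real.exp (K * (2 * (T n * arrayMax a n)) ^ 3) := by
        have := Real.add_one_le_exp (K * (2 * (T n * arrayMax a n)) ^ 3)
        linarith
      have h3 : 0 ≤ 1 + K * (2 * (T n * arrayMax a n)) ^ 3 := by
        have := arrayMax_nonneg a n
        have := hT0 n
        positivity
      have h4 := pow_le_pow_left₀ h3 h2 n
      rw [← Real.exp_nat_mul] at h4
      refine sub_le_sub_right (h4.trans_eq ?_) 1
      congr 1; ring

lemma cos_le_exp {x : ℝ} (hx : |x| ≤ 1) : Real.cos x ≤ Real.exp (-x ^ 2 / 5) := by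
  have h1 := (abs_le.1 (Real.cos_bound hx)).2
  have h2 := Real.add_one_le_exp (-x ^ 2 / 5)
  have hx2 : x ^ 2 ≤ 1 := by rw [← sq_abs]; exact pow_le_one₀ (abs_nonneg _) hx
  have h3 : |x| ^ 4 = x ^ 2 * x ^ 2 := by rw [← sq_abs]; ring
  rw [h3] at h1
  nlinarith [sq_nonneg x]

lemma prod_cos_le_exp (a : ℕ → ℕ → ℝ) (n : ℕ) {t : ℝ} (ht : |t| * arrayMax a n ≤ 1) :
    ∏ k ∈ Finset.Icc 1 n, Real.cos (t * a k n) ≤ Real.exp (-(t * arrayNorm a n) ^ 2 / 5) := by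
  have hta : ∀ k ∈ Finset.Icc 1 n, |t * a k n| ≤ 1 := fun k hk => by
    rw [abs_mul]
    exact (mul_le_mul_of_nonneg_left (abs_le_arrayMax a hk) (abs_nonneg _)).trans ht
  calc _ ≤ ∏ k ∈ Finset.Icc 1 n, Real.exp (-(t * a k n) ^ 2 / 5) := by
        refine Finset.prod_le_prod (fun k hk => (cos_pos_of_abs_le_one (hta k hk)).le) fun k hk => ?_
        exact cos_le_exp (hta k hk)
    _ = _ := by
        rw [← Real.exp_sum, mul_pow, arrayNorm_sq, Finset.mul_sum, ← Finset.sum_neg_distrib,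
          Finset.sum_div]
        simp only [mul_pow]

lemma abs_prod_sub_prod_le {ι : Type*} (s : Finset ι) (f g : ι → ℝ) (hf : ∀ i ∈ s, |f i| ≤ 1)
    (hg : ∀ i ∈ s, |g i| ≤ 1) : |∏ i ∈ s, f i - ∏ i ∈ s, g i| ≤ ∑ i ∈ s, |f i - g i| := by
  classical
  induction s using Finset.induction_on with
  | empty => simp
  | insert i s hi ih =>
    rw [Finset.prod_insert hi, Finset.prod_insert hi, Finset.sum_insert hi]
    have h1 := ih (fun j hj => hf j (Finset.mem_insert_of_mem hj))
      (fun j hj => hg j (Finset.mem_insert_of_mem hj))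
    have h2 : |∏ j ∈ s, f j| ≤ 1 := by
      rw [Finset.abs_prod]
      exact Finset.prod_le_one (fun _ _ => abs_nonneg _)
        fun j hj => hf j (Finset.mem_insert_of_mem hj)
    have h3 := hg i (Finset.mem_insert_self _ _)
    calc |f i * ∏ j ∈ s, f j - g i * ∏ j ∈ s, g j|
        = |(f i - g i) * ∏ j ∈ s, f j + g i * (∏ j ∈ s, f j - ∏ j ∈ s, g j)| := by ring_nf
      _ ≤ |f i - g i| * |∏ j ∈ s, f j| + |g i| * |∏ j ∈ s, f j - ∏ j ∈ s, g j| := by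
        rw [← abs_mul, ← abs_mul]; exact abs_add_le _ _
      _ ≤ |f i - g i| * 1 + 1 * ∑ j ∈ s, |f j - g j| := by gcongr
      _ = _ := by ring

lemma abs_cos_sub_exp_le {x : ℝ} (hx : |x| ≤ 1) :
    |Real.cos x - Real.exp (-x ^ 2 / 2)| ≤ x ^ 4 := by
  have h1 := Real.cos_bound hx
  have hx2 : x ^ 2 ≤ 1 := by rw [← sq_abs]; exact pow_le_one₀ (abs_nonneg _) hx
  have h2 := Real.abs_exp_sub_one_sub_id_le (x := -x ^ 2 / 2) (by
    rw [abs_le]; constructor <;> nlinarith [sq_nonneg x])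
  have h3 : |x| ^ 4 = x ^ 4 := by rw [← abs_pow, abs_of_nonneg (by positivity)]
  rw [h3] at h1
  rw [abs_le] at *
  have h4 : 0 ≤ x ^ 4 := by positivity
  constructor <;> nlinarith

/-- With x_k = s a_k / A_n, each cosine differs from exp(-x_k²/2) by at most x_k⁴. As ∑ x_k² = s²,
the total error is at most s² max x_k², which tends to 0. -/
lemma tendsto_prod_cos (a : ℕ → ℕ → ℝ) (hA : ∀ᶠ n in atTop, 0 < arrayNorm a n)
    (hd : Tendsto (fun n => arrayMax a n / arrayNorm a n) atTop (𝓝 0)) (s : ℝ) :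
    Tendsto (fun n => ∏ k ∈ Finset.Icc 1 n, Real.cos (s / arrayNorm a n * a k n)) atTop
      (𝓝 (Real.exp (-s ^ 2 / 2))) := by
  have h0 : Tendsto (fun n => |s| * (arrayMax a n / arrayNorm a n)) atTop (𝓝 0) := by
    simpa using hd.const_mul |s|
  have h1 : Tendsto (fun n => (|s| * (arrayMax a n / arrayNorm a n)) ^ 2 * s ^ 2) atTop (𝓝 0) := by
    simpa using (h0.pow 2).mul_const (s ^ 2)
  rw [tendsto_iff_norm_sub_tendsto_zero]
  refine squeeze_zero' (Eventually.of_forall fun n => norm_nonneg _) ?_ h1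
  filter_upwards [hA, h0.eventually_le_const zero_lt_one] with n hn hn1
  set A := arrayNorm a n
  have hb : ∀ k ∈ Finset.Icc 1 n, |s / A * a k n| ≤ |s| * (arrayMax a n / A) := fun k hk => by
    rw [abs_mul, abs_div, abs_of_pos hn, div_mul_eq_mul_div, mul_div_assoc]
    gcongr
    exact abs_le_arrayMax a hk
  have hsum : ∑ k ∈ Finset.Icc 1 n, (s / A * a k n) ^ 2 = s ^ 2 := by
    simp only [mul_pow]
    rw [← Finset.mul_sum, ← arrayNorm_sq, div_pow, div_mul_cancel₀ _ (pow_pos hn 2).ne']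
  have hexp : Real.exp (-s ^ 2 / 2) = ∏ k ∈ Finset.Icc 1 n, Real.exp (-(s / A * a k n) ^ 2 / 2) := by
    rw [← Real.exp_sum, ← Finset.sum_div, Finset.sum_neg_distrib, hsum]
  rw [hexp, Real.norm_eq_abs]
  refine (abs_prod_sub_prod_le _ _ _ (fun k _ => Real.abs_cos_le_one _) fun k _ => ?_).trans ?_
  · rw [abs_of_pos (Real.exp_pos _), Real.exp_le_one_iff]
    nlinarith [sq_nonneg (s / A * a k n)]
  · rw [← hsum, Finset.mul_sum]
    refine Finset.sum_le_sum fun k hk => ?_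
    refine (abs_cos_sub_exp_le ((hb k hk).trans hn1)).trans ?_
    have : (s / A * a k n) ^ 4 = |s / A * a k n| ^ 2 * (s / A * a k n) ^ 2 := by
      rw [sq_abs]; ring
    rw [this]
    gcongr
    exact hb k hk

/-! ### A local limit theorem from bounds on characteristic functions -/

section LocalLimit

open FourierTransform SchwartzMap

lemma integral_cexp_mul_gaussian (y : ℝ) :
    ∫ s : ℝ, Complex.exp (-(s * y : ℝ) * Complex.I) * (Real.exp (-s ^ 2 / 2) : ℂ)
      = ((√(2 * Real.pi) * Real.exp (-y ^ 2 / 2) : ℝ) : ℂ) := by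
  have h := fourierIntegral_gaussian (b := 1 / 2) (by norm_num) (-y : ℂ)
  have e : ((Real.pi : ℂ) / (1 / 2)) ^ (1 / 2 : ℂ) = (√(2 * Real.pi) : ℝ) := by
    rw [Real.sqrt_eq_rpow, Complex.ofReal_cpow (by positivity)]
    push_cast
    congr 1
    ring
  rw [e] at h
  rw [Complex.ofReal_mul, Complex.ofReal_exp]
  convert h using 2
  · ext s
    rw [Complex.ofReal_exp]
    push_cast
    congr 2 <;> ring_nf
  · push_cast
    congr 1
    ring

/-- Smooth cutoffs between a compact set and a bounded open set. -/
lemma exists_contDiff_cutoff {K U : Set ℝ} (hK : IsCompact K) (hU : IsOpen U)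
    (hUb : Bornology.IsBounded U) (hKU : K ⊆ U) :
    ∃ f : ℝ → ℝ, ContDiff ℝ ((⊤ : ℕ∞) : WithTop ℕ∞) f ∧ HasCompactSupport f ∧ (∀ x, 0 ≤ f x) ∧
      (∀ x, f x ≤ 1) ∧ (∀ x ∈ K, f x = 1) ∧ ∀ x ∉ U, f x = 0 := by
  obtain ⟨f, hf0, hf1, hf⟩ := exists_contMDiffMap_zero_one_of_isClosed (n := ((⊤ : ℕ∞)))
    (modelWithCornersSelf ℝ ℝ) hU.isClosed_compl hK.isClosed
    (Set.disjoint_left.2 fun x hx hxK => hx (hKU hxK))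
  have h0 : ∀ x ∉ U, f x = 0 := fun x hx => hf0 hx
  refine ⟨f, contMDiff_iff_contDiff.1 f.contMDiff, ?_, fun x => (hf x).1, fun x => (hf x).2,
    fun x hx => hf1 hx, h0⟩
  refine HasCompactSupport.of_support_subset_isCompact hUb.isCompact_closure fun x hx => ?_
  by_contra hxU
  exact hx (h0 x fun h => hxU (subset_closure h))

variable {Ω : Type*} [MeasurableSpace Ω] {μ : Measure Ω} [IsProbabilityMeasure μ]

/-- Fourier inversion, integrated against the law of a random variable. -/
lemma integral_schwartz_eq (f : 𝓢(ℝ, ℂ)) {Z : Ω → ℝ} (hZ : Measurable Z) (y : ℝ) {h : ℝ}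
    (hh : 0 < h) :
    (h⁻¹ : ℂ) * ∫ ω, f ((Z ω - y) / h) ∂μ
      = (2 * Real.pi : ℂ)⁻¹ * ∫ s : ℝ, 𝓕 f (h * s / (2 * Real.pi)) *
          (Complex.exp (-(s * y : ℝ) * Complex.I) *
            ∫ ω, Complex.exp ((s * Z ω : ℝ) * Complex.I) ∂μ) := by
  have hinv : ∀ x : ℝ, f x = ∫ w : ℝ, Complex.exp ((2 * Real.pi * w * x : ℝ) * Complex.I) * 𝓕 f w := by
    intro x
    have h1 : 𝓕⁻ (𝓕 f) x = f x := by rw [FourierTransform.fourierInv_fourier_eq]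
    rw [← h1, SchwartzMap.fourierInv_coe, Real.fourierInv_eq']
    refine integral_congr_ae (Eventually.of_forall fun w => ?_)
    simp only [smul_eq_mul]
    congr 3
    simp; ring
  have hFint : Integrable (fun w : ℝ => 𝓕 f w) := (𝓕 f).integrable
  have hswap : ∫ ω, f ((Z ω - y) / h) ∂μ
      = ∫ w : ℝ, ∫ ω, Complex.exp ((2 * Real.pi * w * ((Z ω - y) / h) : ℝ) * Complex.I) * 𝓕 f w ∂μ := by
    simp_rw [hinv]
    refine integral_integral_swap ?_
    have hF2 : Integrable (fun p : Ω × ℝ => 𝓕 f p.2) (μ.prod volume) := hFint.comp_snd μ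
    refine hF2.mono ?_ ?_
    · refine AEStronglyMeasurable.mul ?_ hF2.aestronglyMeasurable
      refine Measurable.aestronglyMeasurable ?_
      fun_prop
    · refine Eventually.of_forall fun p => ?_
      simp only [Function.uncurry, norm_mul, Complex.norm_exp_ofReal_mul_I, one_mul, le_refl]
  rw [hswap]
  -- The substitution w = h s / (2π) moves the scale h from the characteristic function to the test
  -- function.
  have hsub := Measure.integral_comp_mul_left (fun w : ℝ => ∫ ω, Complex.exp
    ((2 * Real.pi * w * ((Z ω - y) / h) : ℝ) * Complex.I) * 𝓕 f w ∂μ) (h / (2 * Real.pi))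
  have hpi := Real.pi_pos
  rw [abs_of_pos (by positivity), Complex.real_smul] at hsub
  have hpiC : (Real.pi : ℂ) ≠ 0 := by exact_mod_cast hpi.ne'
  have hhC : (h : ℂ) ≠ 0 := by exact_mod_cast hh.ne'
  have hsub' : (h⁻¹ : ℂ) * ∫ w : ℝ, ∫ ω, Complex.exp
      ((2 * Real.pi * w * ((Z ω - y) / h) : ℝ) * Complex.I) * 𝓕 f w ∂μ
      = (2 * Real.pi : ℂ)⁻¹ * ∫ w : ℝ, ∫ ω, Complex.exp ((2 * Real.pi * (h / (2 * Real.pi) * w) *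
        ((Z ω - y) / h) : ℝ) * Complex.I) * 𝓕 f (h / (2 * Real.pi) * w) ∂μ := by
    rw [hsub, ← mul_assoc]
    congr 1
    push_cast
    field_simp
  rw [hsub']
  congr 1
  refine integral_congr_ae (Eventually.of_forall fun s => ?_)
  simp only
  rw [← integral_const_mul, ← integral_const_mul]
  refine integral_congr_ae (Eventually.of_forall fun ω => ?_)
  simp only
  rw [← Complex.exp_add, mul_comm, mul_div_right_comm h s]
  congr 2
  push_cast
  field_simp
  ring

lemma tendsto_integral_schwartz (f : 𝓢(ℝ, ℂ)) {Z : ℕ → Ω → ℝ} (hZ : ∀ n, Measurable (Z n))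
    (y : ℝ) {h : ℕ → ℝ} (hh0 : ∀ᶠ n in atTop, 0 < h n) (hh : Tendsto h atTop (𝓝 0)) {η C b : ℝ}
    (hη : 0 < η) (hb : 0 < b)
    (hbound : ∀ᶠ n in atTop, ∀ s : ℝ, |s| ≤ h n ^ (-(1 + η)) →
      ‖∫ ω, Complex.exp ((s * Z n ω : ℝ) * Complex.I) ∂μ‖ ≤ C * Real.exp (-b * s ^ 2))
    (hlim : ∀ s : ℝ, Tendsto (fun n => ∫ ω, Complex.exp ((s * Z n ω : ℝ) * Complex.I) ∂μ) atTop
      (𝓝 (Real.exp (-s ^ 2 / 2) : ℂ))) :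
    Tendsto (fun n => ((h n)⁻¹ : ℂ) * ∫ ω, f ((Z n ω - y) / h n) ∂μ) atTop
      (𝓝 ((Real.exp (-y ^ 2 / 2) / √(2 * Real.pi) : ℝ) * ∫ x, f x)) := by
  have hpi := Real.pi_pos
  set ψ : ℕ → ℝ → ℂ := fun n s => ∫ ω, Complex.exp ((s * Z n ω : ℝ) * Complex.I) ∂μ with hψ
  have hψ1 : ∀ n s, ‖ψ n s‖ ≤ 1 := fun n s => by
    refine (norm_integral_le_of_norm_le_const (C := 1) (Eventually.of_forall fun ω => ?_)).trans ?_
    · rw [Complex.norm_exp_ofReal_mul_I]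
    · simp
  have hF0 : 𝓕 f (0 : ℝ) = ∫ x, f x := by
    rw [SchwartzMap.fourier_coe, Real.fourier_eq']
    simp
  obtain ⟨M, hM⟩ := (𝓕 f).decay 0 0
  obtain ⟨N, hN⟩ := exists_nat_ge (2 / η)
  rw [div_le_iff₀ hη] at hN
  obtain ⟨D, hD⟩ := (𝓕 f).decay (N + 2) 0
  simp only [pow_zero, norm_iteratedFDeriv_zero, one_mul] at hM hD
  have hM0 := hM.1
  have hmeas : ∀ n, Measurable (ψ n) := fun n => by
    refine StronglyMeasurable.measurable ?_
    refine StronglyMeasurable.integral_prod_right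
      (f := fun s ω => Complex.exp ((s * Z n ω : ℝ) * Complex.I)) ?_
    refine Measurable.stronglyMeasurable ?_
    have := hZ n
    simp only [Function.uncurry_def]
    fun_prop
  have hDCT : Tendsto (fun n => ∫ s : ℝ, 𝓕 f (h n * s / (2 * Real.pi)) *
      (Complex.exp (-(s * y : ℝ) * Complex.I) * ψ n s)) atTop
      (𝓝 (∫ s : ℝ, 𝓕 f (0 : ℝ) *
        (Complex.exp (-(s * y : ℝ) * Complex.I) * (Real.exp (-s ^ 2 / 2) : ℂ)))) := by
    refine tendsto_integral_filter_of_dominated_convergence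
      (fun s => M * (C * Real.exp (-b * s ^ 2)) + D * (2 * Real.pi) ^ (N + 2) * 2 * (1 + s ^ 2)⁻¹)
      ?_ ?_ ?_ ?_
    · refine Eventually.of_forall fun n => ?_
      refine Measurable.aestronglyMeasurable ?_
      have h1 : Measurable fun s : ℝ => 𝓕 f (h n * s / (2 * Real.pi)) :=
        (𝓕 f).continuous.measurable.comp (by fun_prop)
      exact h1.mul (Measurable.mul (by fun_prop) (hmeas n))
    · filter_upwards [hbound, hh0, hh.eventually_le_const zero_lt_one] with n hn hn0 hn1
      refine Eventually.of_forall fun s => ?_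
      have hC : 0 ≤ C * Real.exp (-b * s ^ 2) := by
        have h1 := (norm_nonneg _).trans (hn 0 (by rw [abs_zero]; positivity))
        have h2 : 0 ≤ C := by simpa using h1
        positivity
      have hD0 := hD.1
      have hexp : ‖Complex.exp (-(s * y : ℝ) * Complex.I)‖ = 1 := by
        rw [← Complex.ofReal_neg, Complex.norm_exp_ofReal_mul_I]
      rw [norm_mul, norm_mul, hexp, one_mul]
      rcases le_or_gt |s| (h n ^ (-(1 + η))) with hs | hs
      · refine (mul_le_mul (hM.2 _) (hn s hs) (norm_nonneg _) hM0.le).trans ?_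
        have : 0 ≤ D * (2 * Real.pi) ^ (N + 2) * 2 * (1 + s ^ 2)⁻¹ := by positivity
        linarith
      · have h1 : ‖𝓕 f (h n * s / (2 * Real.pi))‖
            ≤ D * (2 * Real.pi) ^ (N + 2) * 2 * (1 + s ^ 2)⁻¹ := by
          have h2 := hD.2 (h n * s / (2 * Real.pi))
          have hone : 1 ≤ h n ^ (-(1 + η)) :=
            Real.one_le_rpow_of_pos_of_le_one_of_nonpos hn0 hn1 (by linarith)
          have hs1 : 1 ≤ |s| := hone.trans hs.le
          have h3 : h n ^ (-η) ≤ h n * |s| := by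
            calc h n ^ (-η) = h n * h n ^ (-(1 + η)) := by
                  rw [← Real.rpow_one_add' hn0.le (by linarith)]
                  congr 1; ring
              _ ≤ _ := by gcongr
          -- Beyond the range, h |s| ≥ h ^ (-η). As N η ≥ 2, N of these powers absorb h ^ 2, so the
          -- decay of the transform of order N + 2 yields an integrable tail independent of n.
          have h4 : s ^ 2 ≤ (h n * |s|) ^ (N + 2) := by
            have h5 : 1 ≤ h n ^ 2 * (h n ^ (-η)) ^ N := by
              rw [← Real.rpow_mul_natCast hn0.le, ← Real.rpow_two, ← Real.rpow_add hn0]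
              exact Real.one_le_rpow_of_pos_of_le_one_of_nonpos hn0 hn1 (by linarith)
            calc s ^ 2 ≤ (h n ^ 2 * (h n ^ (-η)) ^ N) * s ^ 2 :=
                  le_mul_of_one_le_left (sq_nonneg _) h5
              _ ≤ (h n ^ 2 * (h n * |s|) ^ N) * s ^ 2 := by gcongr
              _ = (h n * |s|) ^ (N + 2) := by rw [pow_add, mul_pow (h n) |s| 2, sq_abs]; ring
          have h6 : ‖h n * s / (2 * Real.pi)‖ ^ (N + 2)
              = (h n * |s|) ^ (N + 2) / (2 * Real.pi) ^ (N + 2) := by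
            rw [Real.norm_eq_abs, abs_div, abs_mul, abs_of_pos hn0,
              abs_of_pos (by positivity : 0 < 2 * Real.pi), div_pow]
          rw [h6, div_mul_eq_mul_div, div_le_iff₀ (by positivity)] at h2
          rw [← div_eq_mul_inv, le_div_iff₀ (by positivity)]
          have h7 : 1 ≤ s ^ 2 := by rw [← sq_abs]; exact one_le_pow₀ hs1
          have h8 := mul_le_mul_of_nonneg_right h4 (norm_nonneg (𝓕 f (h n * s / (2 * Real.pi))))
          nlinarith [norm_nonneg (𝓕 f (h n * s / (2 * Real.pi)))]
        calc _ ≤ D * (2 * Real.pi) ^ (N + 2) * 2 * (1 + s ^ 2)⁻¹ * 1 :=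
              mul_le_mul h1 (hψ1 n s) (norm_nonneg _) (by positivity)
          _ ≤ _ := by
            have : 0 ≤ M * (C * Real.exp (-b * s ^ 2)) := by positivity
            linarith
    · exact (((integrable_exp_neg_mul_sq hb).const_mul C).const_mul M).add
        (integrable_inv_one_add_sq.const_mul _)
    · refine Eventually.of_forall fun s => ?_
      refine Tendsto.mul ?_ ((hlim s).const_mul _)
      have h1 : Tendsto (fun n => h n * s / (2 * Real.pi)) atTop (𝓝 0) := by
        simpa using (hh.mul_const s).div_const (2 * Real.pi)
      exact ((𝓕 f).continuous.tendsto 0).comp h1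
  rw [integral_const_mul, integral_cexp_mul_gaussian, hF0] at hDCT
  have hfin := hDCT.const_mul (2 * Real.pi : ℂ)⁻¹
  have hval : (2 * Real.pi : ℂ)⁻¹ * ((∫ x, f x) *
      ((√(2 * Real.pi) * Real.exp (-y ^ 2 / 2) : ℝ) : ℂ))
      = (Real.exp (-y ^ 2 / 2) / √(2 * Real.pi) : ℝ) * ∫ x, f x := by
    have h1 : (2 * Real.pi)⁻¹ * (√(2 * Real.pi) * Real.exp (-y ^ 2 / 2))
        = Real.exp (-y ^ 2 / 2) / √(2 * Real.pi) := by
      have h2 : √(2 * Real.pi) * √(2 * Real.pi) = 2 * Real.pi :=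
        Real.mul_self_sqrt (by positivity)
      have h3 : 0 < √(2 * Real.pi) := Real.sqrt_pos.2 (by positivity)
      rw [eq_div_iff h3.ne']
      calc _ = (2 * Real.pi)⁻¹ * (√(2 * Real.pi) * √(2 * Real.pi)) * Real.exp (-y ^ 2 / 2) := by ring
        _ = _ := by rw [h2]; field_simp
    rw [← h1]
    push_cast
    ring
  rw [hval] at hfin
  refine hfin.congr' ?_
  filter_upwards [hh0] with n hn
  exact (integral_schwartz_eq f (hZ n) y hn).symm

end LocalLimit

/-! ### From smooth test functions to Jordan measurable sets -/

section LocalLimitSets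

variable {Ω : Type*} [MeasurableSpace Ω] {μ : Measure Ω} [IsProbabilityMeasure μ]

/-- Convergence of the rescaled laws on smooth compactly supported functions implies their
convergence on Jordan measurable sets. -/
lemma tendsto_measureReal_of_forall_contDiff {X : ℕ → Ω → ℝ} (hX : ∀ n, Measurable (X n))
    {h : ℕ → ℝ} (hh : ∀ᶠ n in atTop, 0 < h n) {c : ℝ} (hc : 0 < c)
    (H : ∀ f : ℝ → ℝ, ContDiff ℝ ((⊤ : ℕ∞) : WithTop ℕ∞) f → HasCompactSupport f →
      Tendsto (fun n => h n * ∫ ω, f (X n ω) ∂μ) atTop (𝓝 (c * ∫ x, f x)))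
    {B : Set ℝ} (hB : IsJordanMeasurable B) :
    Tendsto (fun n => h n * μ.real {ω | X n ω ∈ B}) atTop (𝓝 (c * volume.real B)) := by
  obtain ⟨hBb, hBf⟩ := hB
  have hcl : volume.real (closure B) = volume.real B := by
    refine le_antisymm ?_ (measureReal_mono subset_closure
      hBb.isCompact_closure.measure_lt_top.ne)
    have h1 : volume.real (closure B) ≤ volume.real B + volume.real (frontier B) := by
      refine (measureReal_mono ?_ ?_).trans (measureReal_union_le B (frontier B))
      · rw [closure_eq_self_union_frontier]
      · exact ((hBb.subset Set.Subset.rfl).union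
          (hBb.closure.subset frontier_subset_closure)).measure_lt_top.ne
    have h2 : volume.real (frontier B) = 0 := by simp [measureReal_def, hBf]
    linarith
  have hint : volume.real (interior B) = volume.real B := by
    have hfin := hBb.closure.measure_lt_top (μ := volume).ne
    refine le_antisymm (measureReal_mono interior_subset hBb.measure_lt_top.ne) ?_
    have h1 : volume.real B ≤ volume.real (interior B) + volume.real (frontier B) := by
      refine (measureReal_mono ?_ ?_).trans (measureReal_union_le (interior B) (frontier B))
      · rw [← closure_eq_interior_union_frontier]; exact subset_closure
      · rw [← closure_eq_interior_union_frontier]; exact hfin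
    have h2 : volume.real (frontier B) = 0 := by simp [measureReal_def, hBf]
    linarith
  have hfi : ∀ f : ℝ → ℝ, Continuous f → (∀ x, 0 ≤ f x) → (∀ x, f x ≤ 1) → ∀ n,
      Integrable (fun ω => f (X n ω)) μ := fun f hf h0 h1 n => by
    refine Integrable.of_bound (hf.measurable.comp (hX n)).aestronglyMeasurable 1
      (Eventually.of_forall fun ω => ?_)
    rw [Real.norm_of_nonneg (h0 _)]
    exact h1 _
  refine tendsto_order.2 ⟨fun r hr => ?_, fun r hr => ?_⟩
  · rw [← hint, ← div_lt_iff₀' hc] at hr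
    obtain ⟨K, hKB, hK, hrK⟩ : ∃ K ⊆ interior B, IsCompact K ∧ r / c < volume.real K := by
      rcases lt_or_ge (r / c) 0 with h0 | h0
      · exact ⟨∅, Set.empty_subset _, isCompact_empty, by simpa using h0⟩
      · obtain ⟨K, hKB, hK, hrK⟩ := isOpen_interior.exists_lt_isCompact
          ((ENNReal.ofReal_lt_iff_lt_toReal h0
            (hBb.subset interior_subset).measure_lt_top.ne).2 hr)
        exact ⟨K, hKB, hK, (ENNReal.ofReal_lt_iff_lt_toReal h0 hK.measure_lt_top.ne).1 hrK⟩
    obtain ⟨f, hfs, hfc, hf0, hf1, hfK, hfB⟩ := exists_contDiff_cutoff hK isOpen_interior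
      (hBb.subset interior_subset) hKB
    have hKf : volume.real K ≤ ∫ x, f x := by
      rw [← integral_indicator_one hK.measurableSet]
      refine integral_mono ((integrable_indicator_iff hK.measurableSet).2
        (integrableOn_const hK.measure_lt_top.ne)) (hfs.continuous.integrable_of_hasCompactSupport hfc)
        fun x => ?_
      by_cases hx : x ∈ K
      · simp [hx, hfK x hx]
      · simp [hx, hf0 x]
    have hlt : r < c * ∫ x, f x := by
      rw [← div_lt_iff₀' hc]; exact hrK.trans_le hKf
    filter_upwards [(H f hfs hfc).eventually_const_lt hlt, hh] with n hn hn0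
    refine hn.trans_le (mul_le_mul_of_nonneg_left ?_ hn0.le)
    have hms : MeasurableSet {ω | X n ω ∈ interior B} := hX n isOpen_interior.measurableSet
    calc ∫ ω, f (X n ω) ∂μ ≤ ∫ ω, {ω | X n ω ∈ interior B}.indicator 1 ω ∂μ := by
          refine integral_mono (hfi f hfs.continuous hf0 hf1 n) ((integrable_indicator_iff hms).2
            (integrableOn_const (measure_ne_top _ _))) fun ω => ?_
          by_cases hx : X n ω ∈ interior B
          · simp [hx, hf1]
          · simp [hx, hfB _ hx]
      _ = μ.real {ω | X n ω ∈ interior B} := integral_indicator_one hms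
      _ ≤ _ := measureReal_mono (Set.preimage_mono (f := X n) interior_subset)
  · rw [gt_iff_lt, ← hcl, ← lt_div_iff₀' hc] at hr
    have hclc := hBb.isCompact_closure
    obtain ⟨R, hR⟩ := hBb.closure.subset_ball 0
    obtain ⟨U, hBU, hU, hrU⟩ := (closure B).exists_isOpen_lt_of_lt (ENNReal.ofReal (r / c))
      (μ := volume) ((ENNReal.lt_ofReal_iff_toReal_lt hclc.measure_lt_top.ne).2 hr)
    -- Cutting U by a ball keeps it bounded, so that the cutoff has compact support.
    have hVb : Bornology.IsBounded (U ∩ Metric.ball 0 R) :=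
      Metric.isBounded_ball.subset Set.inter_subset_right
    have hV : IsOpen (U ∩ Metric.ball 0 R) := hU.inter Metric.isOpen_ball
    have hrV : volume.real (U ∩ Metric.ball 0 R) < r / c :=
      (ENNReal.lt_ofReal_iff_toReal_lt hVb.measure_lt_top.ne).1
        ((measure_mono Set.inter_subset_left).trans_lt hrU)
    obtain ⟨f, hfs, hfc, hf0, hf1, hfK, hfB⟩ := exists_contDiff_cutoff hclc hV hVb
      (Set.subset_inter hBU hR)
    have hVf : ∫ x, f x ≤ volume.real (U ∩ Metric.ball 0 R) := by
      rw [← integral_indicator_one hV.measurableSet]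
      refine integral_mono (hfs.continuous.integrable_of_hasCompactSupport hfc)
        ((integrable_indicator_iff hV.measurableSet).2
        (integrableOn_const hVb.measure_lt_top.ne)) fun x => ?_
      by_cases hx : x ∈ U ∩ Metric.ball 0 R
      · rw [Set.indicator_of_mem hx]; exact hf1 x
      · rw [Set.indicator_of_notMem hx, hfB x hx]
    have hlt : c * ∫ x, f x < r := by
      rw [← lt_div_iff₀' hc]; exact hVf.trans_lt hrV
    filter_upwards [(H f hfs hfc).eventually_lt_const hlt, hh] with n hn hn0
    refine lt_of_le_of_lt (mul_le_mul_of_nonneg_left ?_ hn0.le) hn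
    have hms : MeasurableSet {ω | X n ω ∈ closure B} := hX n isClosed_closure.measurableSet
    calc μ.real {ω | X n ω ∈ B} ≤ μ.real {ω | X n ω ∈ closure B} :=
          measureReal_mono (Set.preimage_mono (f := X n) subset_closure)
      _ = ∫ ω, {ω | X n ω ∈ closure B}.indicator 1 ω ∂μ := (integral_indicator_one hms).symm
      _ ≤ _ := by
          refine integral_mono ((integrable_indicator_iff hms).2
            (integrableOn_const (measure_ne_top _ _))) (hfi f hfs.continuous hf0 hf1 n) fun ω => ?_
          by_cases hx : X n ω ∈ closure B
          · simp [hx, hfK _ hx]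
          · simp [hx, hf0]

/-- A local limit theorem: if the characteristic functions of `Z n` converge to that of the
standard Gaussian law and are bounded by a Gaussian function on `[-h n ^ (-(1 + η)),
h n ^ (-(1 + η))]`, then the law of `Z n` is Gaussian on the scale `h n`. -/
theorem tendsto_measureReal_of_charFun_bound {Z : ℕ → Ω → ℝ} (hZ : ∀ n, Measurable (Z n))
    (y : ℝ) {h : ℕ → ℝ} (hh0 : ∀ᶠ n in atTop, 0 < h n) (hh : Tendsto h atTop (𝓝 0)) {η C b : ℝ}
    (hη : 0 < η) (hb : 0 < b)
    (hbound : ∀ᶠ n in atTop, ∀ s : ℝ, |s| ≤ h n ^ (-(1 + η)) →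
      ‖∫ ω, Complex.exp ((s * Z n ω : ℝ) * Complex.I) ∂μ‖ ≤ C * Real.exp (-b * s ^ 2))
    (hlim : ∀ s : ℝ, Tendsto (fun n => ∫ ω, Complex.exp ((s * Z n ω : ℝ) * Complex.I) ∂μ) atTop
      (𝓝 (Real.exp (-s ^ 2 / 2) : ℂ))) {B : Set ℝ} (hB : IsJordanMeasurable B) :
    Tendsto (fun n => (h n)⁻¹ * μ.real {ω | (Z n ω - y) / h n ∈ B}) atTop
      (𝓝 (Real.exp (-y ^ 2 / 2) / √(2 * Real.pi) * volume.real B)) := by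
  refine tendsto_measureReal_of_forall_contDiff
    (fun n => ((hZ n).sub_const y).div_const (h n)) (hh0.mono fun n hn => inv_pos.2 hn)
    (by positivity) (fun f hf hfc => ?_) hB
  have hfc' : HasCompactSupport fun x => (f x : ℂ) := hfc.comp_left (g := Complex.ofReal) (by simp)
  have hf' : ContDiff ℝ ((⊤ : ℕ∞) : WithTop ℕ∞) fun x => (f x : ℂ) :=
    Complex.ofRealCLM.contDiff.comp hf
  have key := tendsto_integral_schwartz (hfc'.toSchwartzMap hf') hZ y hh0 hh hη hb hbound hlim
  simp only [HasCompactSupport.toSchwartzMap_toFun] at key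
  have key' := (Complex.continuous_re.tendsto _).comp key
  simp only [integral_complex_ofReal, ← Complex.ofReal_inv, ← Complex.ofReal_mul,
    Function.comp_def, Complex.ofReal_re] at key'
  exact key'

end LocalLimitSets

/-! ### The local limit theorem for lacunary Walsh series -/

lemma tendsto_zero_of_tendsto_pow {x : ℕ → ℝ} (hx : ∀ n, 0 ≤ x n) {k : ℕ} (hk : k ≠ 0)
    (h : Tendsto (fun n => x n ^ k) atTop (𝓝 0)) : Tendsto x atTop (𝓝 0) := by
  have h1 := h.rpow_const (p := ((k : ℝ)⁻¹)) (Or.inr (by positivity))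
  rw [Real.zero_rpow (by positivity)] at h1
  exact h1.congr fun n => Real.pow_rpow_inv_natCast (hx n) hk

lemma eventually_arrayMax_le_one {a : ℕ → ℕ → ℝ} {p : ℝ} (hp : 0 ≤ p) {k : ℕ} (hk : k ≠ 0)
    (h : Tendsto (fun n : ℕ => (n : ℝ) ^ p * arrayMax a n ^ k) atTop (𝓝 0)) :
    ∀ᶠ n in atTop, arrayMax a n ≤ 1 := by
  filter_upwards [h.eventually_le_const zero_lt_one, eventually_ge_atTop 1] with n hn hn1
  have h1 : (1 : ℝ) ≤ (n : ℝ) ^ p := Real.one_le_rpow (by exact_mod_cast hn1) hp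
  have h0 := arrayMax_nonneg a n
  have h2 : arrayMax a n ^ k ≤ 1 := by nlinarith [pow_nonneg h0 k]
  exact (pow_le_one_iff_of_nonneg h0 hk).1 h2

/-- The tenth power is A_n² d_n¹⁰ ≤ n d_n¹² ≤ n d_n⁵, using A_n² ≤ n d_n² and d_n ≤ 1. -/
lemma tendsto_rpow_mul_arrayMax_of_pow_five {a : ℕ → ℕ → ℝ}
    (h : Tendsto (fun n : ℕ => (n : ℝ) * arrayMax a n ^ 5) atTop (𝓝 0)) :
    Tendsto (fun n => arrayNorm a n ^ (2 * (1 / 10 : ℝ)) * arrayMax a n) atTop (𝓝 0) := by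
  have hd := eventually_arrayMax_le_one (a := a) (p := 1) (k := 5) zero_le_one (by norm_num)
    (by simpa using h)
  refine tendsto_zero_of_tendsto_pow (k := 10)
    (fun n => mul_nonneg (Real.rpow_nonneg (arrayNorm_nonneg a n) _) (arrayMax_nonneg a n))
    (by norm_num) ?_
  refine squeeze_zero' (Eventually.of_forall fun n => by
    have := arrayMax_nonneg a n
    have := arrayNorm_nonneg a n
    positivity) ?_ h
  filter_upwards [hd] with n hn
  have h0 := arrayMax_nonneg a n
  have h1 : arrayNorm a n ^ 2 ≤ n * arrayMax a n ^ 2 := by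
    have := pow_le_pow_left₀ (arrayNorm_nonneg a n) (arrayNorm_le a n) 2
    rwa [mul_pow, Real.sq_sqrt (Nat.cast_nonneg n)] at this
  calc (arrayNorm a n ^ (2 * (1 / 10 : ℝ)) * arrayMax a n) ^ 10
      = arrayNorm a n ^ 2 * arrayMax a n ^ 10 := by
        rw [mul_pow, ← Real.rpow_mul_natCast (arrayNorm_nonneg a n), ← Real.rpow_two]
        norm_num
    _ ≤ n * arrayMax a n ^ 2 * arrayMax a n ^ 10 := by gcongr
    _ = n * arrayMax a n ^ 5 * arrayMax a n ^ 7 := by ring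
    _ ≤ n * arrayMax a n ^ 5 * 1 := by gcongr; exact pow_le_one₀ h0 hn
    _ = _ := mul_one _

/-- Eventually d_n ≤ 1, hence A_n ≤ √n and A_n^{6γ} ≤ n^{3γ} ≤ n^ε. -/
lemma tendsto_mul_rpow_mul_arrayMax_pow_three {a : ℕ → ℕ → ℝ} {ε γ : ℝ} (hγ : 0 ≤ γ)
    (hγε : 3 * γ ≤ ε)
    (h : Tendsto (fun n : ℕ => (n : ℝ) ^ (1 + ε) * arrayMax a n ^ 3) atTop (𝓝 0)) :
    Tendsto (fun n : ℕ => (n : ℝ) * (arrayNorm a n ^ (2 * γ) * arrayMax a n) ^ 3) atTop (𝓝 0) := by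
  have hd := eventually_arrayMax_le_one (a := a) (p := 1 + ε) (k := 3) (by linarith) (by norm_num) h
  refine squeeze_zero' (Eventually.of_forall fun n => by
    have := arrayMax_nonneg a n
    have := arrayNorm_nonneg a n
    positivity) ?_ h
  filter_upwards [hd, eventually_ge_atTop 1] with n hn hn1
  have h0 := arrayMax_nonneg a n
  have hn1' : (1 : ℝ) ≤ n := by exact_mod_cast hn1
  have h1 : (arrayNorm a n ^ (2 * γ)) ^ 3 ≤ (n : ℝ) ^ ε := by
    calc (arrayNorm a n ^ (2 * γ)) ^ 3 ≤ ((√n) ^ (2 * γ)) ^ 3 := by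
          have h2 : arrayNorm a n ≤ √n :=
            (arrayNorm_le a n).trans (mul_le_of_le_one_right (Real.sqrt_nonneg _) hn)
          have := arrayNorm_nonneg a n
          gcongr
      _ = (n : ℝ) ^ (3 * γ) := by
          rw [← Real.rpow_mul_natCast (Real.sqrt_nonneg _), Real.sqrt_eq_rpow,
            ← Real.rpow_mul (Nat.cast_nonneg n)]
          congr 1; push_cast; ring
      _ ≤ _ := Real.rpow_le_rpow_of_exponent_le hn1' hγε
  calc (n : ℝ) * (arrayNorm a n ^ (2 * γ) * arrayMax a n) ^ 3
      = n * (arrayNorm a n ^ (2 * γ)) ^ 3 * arrayMax a n ^ 3 := by ring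
    _ ≤ n * (n : ℝ) ^ ε * arrayMax a n ^ 3 := by gcongr
    _ = _ := by rw [Real.rpow_add (by linarith), Real.rpow_one]

/-- The local limit theorem on the scale `A_n ^ (-2 δ)`, for `δ < γ + 1 / 2` and any `γ` with
`A_n ^ (2 γ) d_n → 0` (and `n (A_n ^ (2 γ) d_n) ^ 3 → 0` if `q < 2`). -/
theorem IsLacunary.tendsto_measureReal_walshSum {q : ℝ} (hq : 1 < q) {m : ℕ → ℕ}
    (hm : IsLacunary q m) {a : ℕ → ℕ → ℝ} (hA : Tendsto (fun n => arrayNorm a n) atTop atTop)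
    {γ : ℝ} (hγ : 0 ≤ γ)
    (hT : Tendsto (fun n => arrayNorm a n ^ (2 * γ) * arrayMax a n) atTop (𝓝 0))
    (hT' : q < 2 → Tendsto (fun n : ℕ => (n : ℝ) * (arrayNorm a n ^ (2 * γ) * arrayMax a n) ^ 3)
      atTop (𝓝 0))
    (y : ℝ) {B : Set ℝ} (hB : IsJordanMeasurable B) {δ : ℝ} (hδ : 0 < δ) (hδγ : δ < γ + 1 / 2) :
    Tendsto (fun n => arrayNorm a n ^ (2 * δ) * volume.real {x : ℝ | x ∈ Set.Icc (0 : ℝ) 1 ∧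
        walshSum a m n x / arrayNorm a n - y ∈ (1 / arrayNorm a n ^ (2 * δ)) • B})
      atTop (𝓝 (Real.exp (-y ^ 2 / 2) / √(2 * Real.pi) * volume.real B)) := by
  have hA0 : ∀ᶠ n in atTop, 0 < arrayNorm a n := hA.eventually_gt_atTop 0
  have hA1 : ∀ᶠ n in atTop, 1 ≤ arrayNorm a n := hA.eventually_ge_atTop 1
  obtain ⟨r, hr, hφ⟩ := hm.exists_norm_integral_cexp_sub_le hq a
    (T := fun n => arrayNorm a n ^ (2 * γ))
    (fun n => Real.rpow_nonneg (arrayNorm_nonneg a n) _) hT hT'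
  let μ : Measure ℝ := volume.restrict (Set.Icc 0 1)
  have : IsProbabilityMeasure μ := ⟨by simp [μ]⟩
  have hψ : ∀ n (s : ℝ), ∫ x, Complex.exp ((s * (walshSum a m n x / arrayNorm a n) : ℝ) * Complex.I) ∂μ
      = ∫ x in (0 : ℝ)..1, Complex.exp ((s / arrayNorm a n * walshSum a m n x : ℝ) * Complex.I) := by
    intro n s
    rw [intervalIntegral.integral_of_le zero_le_one, ← integral_Icc_eq_integral_Ioc]
    refine integral_congr_ae (Eventually.of_forall fun x => ?_)
    simp only
    congr 3
    ring
  -- Chosen so that h ^ (-(1 + η)) = A_n ^ (2γ + 1); dividing s by A_n then gives the range |t| ≤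
  -- A_n ^ (2γ).
  set η : ℝ := (γ + 1 / 2) / δ - 1 with hηdef
  have hη : 0 < η := by rw [hηdef, sub_pos, one_lt_div hδ]; exact hδγ
  have hrange : ∀ᶠ n in atTop, ∀ s : ℝ,
      |s| ≤ (arrayNorm a n ^ (-(2 * δ))) ^ (-(1 + η)) →
        |s / arrayNorm a n| ≤ arrayNorm a n ^ (2 * γ) := by
    filter_upwards [hA0] with n hn s hs
    rw [abs_div, abs_of_pos hn, div_le_iff₀ hn]
    refine hs.trans_eq ?_
    rw [← Real.rpow_mul hn.le, ← Real.rpow_add_one hn.ne']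
    congr 1
    rw [hηdef]
    field_simp
    ring
  have hsmall : ∀ᶠ n in atTop, arrayNorm a n ^ (2 * γ) * arrayMax a n ≤ 1 :=
    hT.eventually_le_const zero_lt_one
  -- C = 2 because the relative error is eventually at most 1; b = 1/5 is the rate in `cos_le_exp`.
  have hlim := tendsto_measureReal_of_charFun_bound (μ := μ)
    (Z := fun n x => walshSum a m n x / arrayNorm a n)
    (fun n => (measurable_walshSum a m n).div_const _) y
    (h := fun n => arrayNorm a n ^ (-(2 * δ)))
    (hA0.mono fun n hn => Real.rpow_pos_of_pos hn _)
    ((tendsto_rpow_neg_atTop (by positivity)).comp hA) (η := η) (C := 2) (b := 1 / 5) hη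
    (by norm_num) ?_ ?_ hB
  · refine hlim.congr' ?_
    filter_upwards [hA0] with n hn
    have hp : 0 < arrayNorm a n ^ (2 * δ) := Real.rpow_pos_of_pos hn _
    rw [Real.rpow_neg hn.le, inv_inv]
    congr 1
    rw [measureReal_restrict_apply' measurableSet_Icc]
    congr 1
    ext x
    rw [Set.mem_inter_iff, and_comm, Set.mem_ofPred_eq, Set.mem_ofPred_eq,
      Set.mem_smul_set_iff_inv_smul_mem₀ (by positivity), smul_eq_mul, one_div, inv_inv,
      div_inv_eq_mul, mul_comm]
  · filter_upwards [hφ, hrange, hA0, hsmall, hr.eventually_le_const zero_lt_one]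
      with n h1 h2 hn h3 h4 s hs
    have hs' := h2 s hs
    rw [hψ]
    have h5 := h1 _ hs'
    have hsd : |s / arrayNorm a n| * arrayMax a n ≤ 1 :=
      (mul_le_mul_of_nonneg_right hs' (arrayMax_nonneg a n)).trans h3
    have h6 := prod_cos_le_exp a n hsd
    rw [div_mul_cancel₀ _ hn.ne'] at h6
    have h7 : 0 ≤ ∏ k ∈ Finset.Icc 1 n, Real.cos (s / arrayNorm a n * a k n) :=
      Finset.prod_nonneg fun k hk => (cos_pos_of_abs_le_one (by
        rw [abs_mul]
        exact (mul_le_mul_of_nonneg_left (abs_le_arrayMax a hk) (abs_nonneg _)).trans hsd)).le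
    have h8 := norm_le_norm_add_norm_sub' (∫ x in (0 : ℝ)..1,
      Complex.exp ((s / arrayNorm a n * walshSum a m n x : ℝ) * Complex.I))
      ((∏ k ∈ Finset.Icc 1 n, Real.cos (s / arrayNorm a n * a k n) : ℝ) : ℂ)
    rw [Complex.norm_real, Real.norm_of_nonneg h7] at h8
    have h9 : -(1 / 5) * s ^ 2 = -s ^ 2 / 5 := by ring
    rw [h9]
    nlinarith
  · intro s
    simp only [hψ]
    have hd : Tendsto (fun n => arrayMax a n / arrayNorm a n) atTop (𝓝 0) := by
      refine squeeze_zero' (Eventually.of_forall fun n =>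
        div_nonneg (arrayMax_nonneg a n) (arrayNorm_nonneg a n)) ?_ (tendsto_inv_atTop_zero.comp hA)
      filter_upwards [hA1, hsmall] with n hn h1
      rw [Function.comp_apply, ← one_div]
      gcongr
      exact (le_mul_of_one_le_left (arrayMax_nonneg a n)
        (Real.one_le_rpow hn (by positivity))).trans h1
    have hprod := tendsto_prod_cos a hA0 hd s
    have hprodC : Tendsto (fun n => ((∏ k ∈ Finset.Icc 1 n,
        Real.cos (s / arrayNorm a n * a k n) : ℝ) : ℂ)) atTop (𝓝 (Real.exp (-s ^ 2 / 2) : ℂ)) :=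
      (Complex.continuous_ofReal.tendsto _).comp hprod
    have hdiff : Tendsto (fun n => (∫ x in (0 : ℝ)..1,
        Complex.exp ((s / arrayNorm a n * walshSum a m n x : ℝ) * Complex.I))
        - ((∏ k ∈ Finset.Icc 1 n, Real.cos (s / arrayNorm a n * a k n) : ℝ) : ℂ))
        atTop (𝓝 0) := by
      refine squeeze_zero_norm' ?_ (by simpa using hr.mul hprod)
      filter_upwards [hφ, hA1, hA.eventually_ge_atTop |s|] with n h1 hn hs
      refine h1 _ ?_
      rw [abs_div, abs_of_pos (by linarith : 0 < arrayNorm a n)]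
      exact (div_le_one_of_le₀ hs (by linarith)).trans (Real.one_le_rpow hn (by positivity))
    simpa using hdiff.add hprodC

theorem mainTheorem4
    (q : ℝ) (hq : 1 < q)
    (m : ℕ → ℕ) (hm : IsLacunary q m)
    (a : ℕ → ℕ → ℝ)
    (hA : Tendsto (fun n : ℕ => arrayNorm a n) atTop atTop)
    (ε : ℝ)
    (hq_ge : 2 ≤ q →
      (∃ κ₄ : ℝ, Tendsto (fun n : ℕ => ∑ k ∈ Finset.Icc 1 n, a k n ^ 4) atTop (𝓝 κ₄)) ∧
      Tendsto (fun n : ℕ => (n : ℝ) * arrayMax a n ^ 5) atTop (𝓝 0))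
    (hq_lt : q < 2 →
      0 < ε ∧
      Tendsto (fun n : ℕ => (n : ℝ) ^ (1 + ε) * arrayMax a n ^ 3) atTop (𝓝 0))
    (y : ℝ) (B : Set ℝ) (hB : IsJordanMeasurable B) (hB_pos : 0 < volume B)
    (δ : ℝ) (hδ_pos : 0 < δ) (hδ_lt : δ < walshGamma q ε + 1 / 2) :
    Tendsto
      (fun n : ℕ => arrayNorm a n ^ (2 * δ) *
        volume.real {x : ℝ | x ∈ Set.Icc (0 : ℝ) 1 ∧
          walshSum a m n x / arrayNorm a n - y ∈ (1 / arrayNorm a n ^ (2 * δ)) • B})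
      atTop (𝓝 (volume.real B * (Real.exp (-y ^ 2 / 2) / Real.sqrt (2 * Real.pi)))) := by
  rw [mul_comm (volume.real B)]
  rcases le_or_gt 2 q with hq2 | hq2
  · rw [walshGamma, if_pos hq2] at hδ_lt
    exact hm.tendsto_measureReal_walshSum hq hA (by norm_num)
      (tendsto_rpow_mul_arrayMax_of_pow_five (hq_ge hq2).2) (fun h => absurd hq2 (not_le.2 h))
      y hB hδ_pos hδ_lt
  · obtain ⟨hε, h⟩ := hq_lt hq2
    rw [walshGamma, if_neg (not_le.2 hq2)] at hδ_lt
    have hγ : 0 ≤ min (ε / 3) (1 / 3) := le_min (by positivity) (by norm_num)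
    have h3 := tendsto_mul_rpow_mul_arrayMax_pow_three hγ
      (by linarith [min_le_left (ε / 3) (1 / 3)]) h
    have h0 : ∀ n, 0 ≤ arrayNorm a n ^ (2 * min (ε / 3) (1 / 3)) * arrayMax a n := fun n =>
      mul_nonneg (Real.rpow_nonneg (arrayNorm_nonneg a n) _) (arrayMax_nonneg a n)
    refine hm.tendsto_measureReal_walshSum hq hA hγ ?_ (fun _ => h3) y hB hδ_pos hδ_lt
    refine tendsto_zero_of_tendsto_pow h0 (k := 3) (by norm_num) ?_
    refine squeeze_zero' (Eventually.of_forall fun n => pow_nonneg (h0 n) 3) ?_ h3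
    filter_upwards [eventually_ge_atTop 1] with n hn
    exact le_mul_of_one_le_left (pow_nonneg (h0 n) 3) (by exact_mod_cast hn)
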